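/- **Setting.** Let $p$ be an odd prime, $g\ge 1$, and $\eta\in\mathbb C$ a primitive $p$-th root of unity. Fractions in exponents of $\eta$ are taken in $\mathbb Z/p$; $G(a)=\sum_{t\in\mathbb Z/p}\eta^{at^2}$; $\tau(i)=\binom{i+1}{2}=\tfrac12 i(i+1)$ for $i\in\mathbb Z/p$, and $I_p=\tau(\mathbb Z/p)$. Let $\mathrm e_1,\dots,\mathrm e_g$ be the coordinate vectors of $(\mathbb Z/p)^g$ and put $\mathrm e_{g+1}=0$. Let $V$ be the complex vector space with basis $e_{\hat j}$, $\hat j\in(\mathbb Z/p)^g$, with the right action of invertible operators $x_1,\dots,x_{2g}$ and the endomorphisms $\Psi_1,\dots,\Psi_{2g}$ given, for $1\le k\le g$, by $$e_{\hat j}x_{2k-1}=\eta^{j_k}e_{\hat j},\qquad e_{\hat j}x_{2k}=e_{\hat j-\mathrm e_k+\mathrm e_{k+1}},$$ $$\Psi_{2k-1}(e_{\hat j})=\eta^{\tau(j_k)}e_{\hat j},\qquad \Psi_{2k}(e_{\hat j})=\frac{G(\frac12)}{p}\sum_{s\in\mathbb Z/p}\eta^{-\frac12(s+\frac12)^2}e_{\hat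 j+s(\mathrm e_k-\mathrm e_{k+1})}.$$ Let $L_g^\eta=V\otimes\langle u_1,\dots,u_{2g}\rangle_{\mathbb C}$, write $vu_m=v\otimes u_m$, put $u_{-1}=u_{2g+2}=0$, and define $\hat\Psi_l\in\mathrm{End}(L_g^\eta)$ by $$\hat\Psi_{2k-1}(vu_m)=\Psi_{2k-1}(v)u_m-\delta_{m,2k}\,\Psi_{2k-1}(v)\{x_1x_3\cdots x_{2k-3}\cdot x_{2k}x_{2k+2}\cdots x_{2g}\}(u_{2k-1}-u_{2k-3}),$$ $$\hat\Psi_{2k}(vu_m)=\Psi_{2k}(v)u_m+\delta_{m,2k-1}\,\Psi_{2k}(v)\{x_1x_3\cdots x_{2k-1}\cdot x_{2k}x_{2k+2}\cdots x_{2g}\}^{-1}(u_{2k}-u_{2k+2}).$$ **Constants.** For $a\in I_p$ let $m_a\in\{0,1,\dots,\frac{p-1}2\}$ be the element with $m_a^2=2a+\frac14$ in $\mathbb Z/p$. Put $B^a_s=C^a_s=0$ if $a\notin I_p$, and for $a\in I_p$ put $B^a_s=\sum_{m\in\mathbb Z/p,\ m^2=2a+1/4}\eta^{ms}$, i.e.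 $B^a_s=\eta^{m_as}+\eta^{-m_as}$ if $a\ne-\frac18$, and $B^{-1/8}_s=1$. With $F_s(c)=\{\eta^{c(s-\frac12)}+\eta^{-c(s-\frac12)}\}(\eta^{\frac c2}-\eta^{-\frac c2})^{-1}$ put $C^0_s=F_s(-1)$, $C^{-1/8}_s=F_s(-\tfrac12)$, and $C^a_s=F_s(m_a-\tfrac12)-F_s(m_a+\tfrac12)$ for the other $a\in I_p$. **Theorem.** Each $\hat\Psi_l$ ($1\le l\le 2g$) has a unique multiplicative Jordan decomposition $\hat\Psi_l=\hat\Psi_{l,\mathrm{ss}}\hat\Psi_{l,\mathrm{uni}}$ (commuting semisimple and unipotent factors). One has $(\hat\Psi_{l,\mathrm{ss}})^p=1$, and for $a\in\mathbb Z/p$ the operator $\Phi(\hat\Psi_{l,\mathrm{ss}};a)=\frac1p\sum_{n\in\mathbb Z/p}\eta^{-an}(\hat\Psi_{l,\mathrm{ss}})^n$ is the projection onto the $\eta^a$-eigenspace of $\hat\Psi_{l,\mathrm{ss}}$ along the sum of its $\eta^b$-eigenspaces, $b\ne a$. For $1\le k\le g$, $1\le m\le 2g$, $a\in\mathbb Z/p$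 and $\hat i,\hat j\in(\mathbb Z/p)^g$: 1. (unipotent parts) $$(\hat\Psi_{2k-1,\mathrm{uni}}-1)(e_{\hat i}u_m)=-\delta_{m,2k}\,\delta_{i_k,0}\,\eta^{i_1+\dots+i_{k-1}}\,e_{\hat i-\mathrm e_k}(u_{2k-1}-u_{2k-3}),$$ $$(\hat\Psi_{2k,\mathrm{uni}}-1)(e_{\hat i}u_m)=\delta_{m,2k-1}\,\frac1p\,\eta^{-(i_1+\dots+i_k)}\sum_{s\in\mathbb Z/p}\eta^{-s}\,e_{\hat i+s\mathrm e_k+(1-s)\mathrm e_{k+1}}(u_{2k}-u_{2k+2}).$$ 2. (semisimple part, odd index) $$\Phi(\hat\Psi_{2k-1,\mathrm{ss}};a)(e_{\hat j}u_m)=\delta_{a,\tau(j_k)}\,e_{\hat j}u_m-\delta_{m,2k}\,\delta_{j_k\ne0}\,\bigl(\delta_{a,\tau(j_k)}-\delta_{a,\tau(j_k-1)}\bigr)(1-\eta^{-j_k})^{-1}\eta^{j_1+\dots+j_{k-1}}\,e_{\hat j-\mathrm e_k}(u_{2k-1}-u_{2k-3}).$$ 3. (semisimple part, even index) $$\Phi(\hat\Psi_{2k,\mathrm{ss}};a)(e_{\hat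 i}u_m)=\frac1p\sum_{s\in\mathbb Z/p}\eta^{-\frac s2}B^a_s\,e_{\hat i+s(\mathrm e_k-\mathrm e_{k+1})}u_m+\delta_{m,2k-1}\,\frac1p\sum_{s\in\mathbb Z/p}\eta^{-(i_1+\dots+i_k)}\eta^{-s}C^a_s\,e_{\hat i+s\mathrm e_k+(1-s)\mathrm e_{k+1}}(u_{2k}-u_{2k+2}).$$ 4. (spectrum) For every $1\le l\le 2g$ the spectrum of $\hat\Psi_l$ on $L_g^\eta$ is $\{\eta^a\mid a\in I_p\}$. -/

import Mathlib

open scoped TensorProduct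

noncomputable section

namespace Braid

/-- `η ^ a` for a residue class `a` modulo `p` (meaningful when `η ^ p = 1`). -/
def pw {p : ℕ} (η : ℂ) (a : ZMod p) : ℂ := η ^ a.val

/-- The map `τ_p : i ↦ binom (i + 1) 2 = i (i + 1) / 2` on `ℤ/p` (`p` odd). -/
def tau {p : ℕ} (i : ZMod p) : ZMod p := i * (i + 1) * 2⁻¹

/-- `I_p`, the image of `τ_p`. -/
def Ip (p : ℕ) : Set (ZMod p) := Set.range (tau (p := p))

/-- The quadratic Gauss sum `G(a) = ∑ t, η ^ (a t ^ 2)`. -/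
def gauss {p : ℕ} [Fact p.Prime] (η : ℂ) (a : ZMod p) : ℂ := ∑ t : ZMod p, pw η (a * t ^ 2)

/-- Multi-indices `(j_1, …, j_g)` with entries in `ℤ/p`. The element `k : Fin g` stands for
the position `k + 1` among `1, …, g`. -/
abbrev MultiIndex (p g : ℕ) : Type := Fin g → ZMod p

/-- The coordinate vector at the zero-based position `n`; it is `0` if there is no such
position (`n = g`). -/
def re (p g : ℕ) (n : ℕ) : MultiIndex p g := fun i => if (i : ℕ) = n then 1 else 0

/-- The labels `1, …, 2g`: for the one-based position `k`, `inl k` is the odd label `2k - 1`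
and `inr k` is the even label `2k`. -/
abbrev Label (g : ℕ) : Type := Fin g ⊕ Fin g

/-! ### The space `V` -/

/-- `V_g^η`, the complex vector space with basis `e_j`, `j ∈ (ℤ/p)^g`. -/
abbrev V (p g : ℕ) : Type := MultiIndex p g → ℂ

/-- The basis vector `e_j`. -/
def e {p g : ℕ} (j : MultiIndex p g) : V p g := Pi.single j 1

/-- The linear endomorphism of `V` with prescribed values on the basis `e_j`. -/
def onBasis {p g : ℕ} [Fact p.Prime] (f : MultiIndex p g → V p g) : Module.End ℂ (V p g) :=
  Fintype.linearCombination ℂ f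

/-- The right action of `x_l ^ n` on `V`:
`e_j x_{2k-1} = η^{j_k} e_j` and `e_j x_{2k} = e_{j - e_k + e_{k+1}}`. -/
def letter {p g : ℕ} [Fact p.Prime] (η : ℂ) : Label g × ℤ → Module.End ℂ (V p g)
  | (Sum.inl k, n) => onBasis fun j => pw η ((n : ZMod p) * j k) • e j
  | (Sum.inr k, n) => onBasis fun j => e (j + (n : ZMod p) • (re p g (k + 1) - re p g k))

/-- The right action `v ↦ v w` of a word `w = x_{l_1}^{n_1} x_{l_2}^{n_2} ⋯`; the leftmost
letter acts first. -/
def rightAct {p g : ℕ} [Fact p.Prime] (η : ℂ) (w : List (Label g × ℤ)) : Module.End ℂ (V p g) :=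
  (w.map (letter η)).reverse.prod

/-- The formal inverse of a word. -/
def wordInv {g : ℕ} (w : List (Label g × ℤ)) : List (Label g × ℤ) :=
  (w.map fun x => (x.1, -x.2)).reverse

theorem onBasis_e {p g : ℕ} [Fact p.Prime] (f : MultiIndex p g → V p g) (j : MultiIndex p g) :
    onBasis f (e j) = f j := by
  simp [onBasis, e, Fintype.linearCombination_apply, Pi.single_apply]

theorem pw_add {p : ℕ} [Fact p.Prime] {η : ℂ} (hη : η ^ p = 1) (a b : ZMod p) :
    pw η (a + b) = pw η a * pw η b := by
  rw [pw, pw, pw, ← pow_add, ZMod.val_add, ← pow_mod_orderOf,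
    Nat.mod_mod_of_dvd _ (orderOf_dvd_of_pow_eq_one hη), pow_mod_orderOf]

theorem letter_neg {p g : ℕ} [Fact p.Prime] {η : ℂ} (hη : η ^ p = 1) (l : Label g) (n : ℤ) :
    letter (p := p) η (l, -n) * letter η (l, n) = 1 := by
  refine (Pi.basisFun ℂ (MultiIndex p g)).ext fun j => ?_
  have hj : Pi.basisFun ℂ (MultiIndex p g) j = e j := by simp [e, Pi.basisFun_apply]
  rw [hj]
  cases l with
  | inl k =>
    simp only [letter, Module.End.mul_apply, onBasis_e, map_smul, smul_smul, ← pw_add hη,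
      Module.End.one_apply]
    simp [pw]
  | inr k => simp [letter, Module.End.mul_apply, onBasis_e]

/-- The inverse word acts as the inverse operator. -/
theorem rightAct_wordInv {p g : ℕ} [Fact p.Prime] {η : ℂ} (hη : η ^ p = 1)
    (w : List (Label g × ℤ)) : rightAct (p := p) η (wordInv w) * rightAct η w = 1 := by
  induction w with
  | nil => simp [rightAct, wordInv]
  | cons x w ih =>
    simp only [rightAct, wordInv, List.map_cons, List.reverse_cons, List.prod_append,
      List.map_append, List.map_nil, List.reverse_append, List.reverse_nil, List.nil_append,
      List.prod_cons, List.prod_nil, mul_one, List.map_reverse, List.reverse_reverse,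
      List.singleton_append] at ih ⊢
    rw [mul_assoc, ← mul_assoc _ _ (letter η x), ih, one_mul]
    exact letter_neg hη x.1 x.2

/-- The action of `Ψ_l` on `V`. -/
def psi {p g : ℕ} [Fact p.Prime] (η : ℂ) : Label g → Module.End ℂ (V p g)
  | Sum.inl k => onBasis fun j => pw η (tau (j k)) • e j
  | Sum.inr k => onBasis fun j => (gauss η (2⁻¹ : ZMod p) / p) •
      ∑ s : ZMod p, pw η (-(2⁻¹ * (s + 2⁻¹) ^ 2)) • e (j + s • (re p g k - re p g (k + 1)))

/-! ### The space `L` -/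

/-- The complex vector space with basis `u_1, …, u_{2g}`. -/
abbrev U (g : ℕ) : Type := Label g → ℂ

/-- The basis vector `u_l`. -/
def u {g : ℕ} (l : Label g) : U g := Pi.single l 1

/-- `u_{2k-1} - u_{2k-3}` for the label `2k - 1` and `u_{2k} - u_{2k+2}` for the label `2k`,
where `u_{-1} = 0` and `u_{2g+2} = 0`. -/
def du {g : ℕ} : Label g → U g
  | Sum.inl k => u (Sum.inl k) -
      if (k : ℕ) = 0 then 0 else u (Sum.inl ⟨k - 1, lt_of_le_of_lt (Nat.sub_le _ _) k.2⟩)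
  | Sum.inr k => u (Sum.inr k) -
      if h : (k : ℕ) + 1 < g then u (Sum.inr ⟨k + 1, h⟩) else 0

/-- `L_g^η = V_g^η ⊗ ⟨u_1, …, u_{2g}⟩`. -/
abbrev L (p g : ℕ) : Type := V p g ⊗[ℂ] U g

/-- The word `x_1 x_3 ⋯ x_{2k-3} · x_{2k} x_{2k+2} ⋯ x_{2g}`. -/
def oddWord {g : ℕ} (k : Fin g) : List (Label g × ℤ) :=
  ((List.finRange g).filter (· < k)).map (fun r => ((Sum.inl r : Label g), (1 : ℤ))) ++
    ((List.finRange g).filter (k ≤ ·)).map (fun r => ((Sum.inr r : Label g), (1 : ℤ)))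

/-- The word `x_1 x_3 ⋯ x_{2k-1} · x_{2k} x_{2k+2} ⋯ x_{2g}`. -/
def evenWord {g : ℕ} (k : Fin g) : List (Label g × ℤ) :=
  ((List.finRange g).filter (· ≤ k)).map (fun r => ((Sum.inl r : Label g), (1 : ℤ))) ++
    ((List.finRange g).filter (k ≤ ·)).map (fun r => ((Sum.inr r : Label g), (1 : ℤ)))

/-- The linear map `U → U` that sends `u_l` to `w` and the other basis vectors to `0`. -/
def sendTo {g : ℕ} (l : Label g) (w : U g) : Module.End ℂ (U g) :=
  Fintype.linearCombination ℂ fun m : Label g => if m = l then w else 0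

/-- The operators `Ψ̂_l` on `L`:
`Ψ̂_{2k-1} (v ⊗ u_m) = Ψ_{2k-1}(v) ⊗ u_m - δ_{m,2k} Ψ_{2k-1}(v) w ⊗ (u_{2k-1} - u_{2k-3})` with
`w = oddWord k`, and
`Ψ̂_{2k} (v ⊗ u_m) = Ψ_{2k}(v) ⊗ u_m + δ_{m,2k-1} Ψ_{2k}(v) w⁻¹ ⊗ (u_{2k} - u_{2k+2})` with
`w = evenWord k`. -/
def psiHat {p g : ℕ} [Fact p.Prime] (η : ℂ) : Label g → Module.End ℂ (L p g)
  | Sum.inl k => TensorProduct.map (psi η (Sum.inl k)) LinearMap.id -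
      TensorProduct.map (rightAct η (oddWord k) ∘ₗ psi η (Sum.inl k))
        (sendTo (Sum.inr k) (du (Sum.inl k)))
  | Sum.inr k => TensorProduct.map (psi η (Sum.inr k)) LinearMap.id +
      TensorProduct.map (rightAct η (wordInv (evenWord k)) ∘ₗ psi η (Sum.inr k))
        (sendTo (Sum.inl k) (du (Sum.inr k)))

/-! ### Jordan decomposition and spectral projections -/

/-- `A = S T` is the multiplicative Jordan decomposition of `A`: `S` is semisimple, `T` is
unipotent, and they commute. -/
structure IsMulJordan {M : Type*} [AddCommGroup M] [Module ℂ M] (A S T : Module.End ℂ M) :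
    Prop where
  semisimple : S.IsSemisimple
  unipotent : IsNilpotent (T - 1)
  commute : Commute S T
  eq_mul : A = S * T

/-- `Φ(S; a) = (1/p) ∑_{n ∈ ℤ/p} η^{-an} S^n`. -/
def specProj {p : ℕ} [Fact p.Prime] {M : Type*} [AddCommGroup M] [Module ℂ M] (η : ℂ)
    (S : Module.End ℂ M) (a : ZMod p) : Module.End ℂ M :=
  (p : ℂ)⁻¹ • ∑ n : ZMod p, pw η (-(a * n)) • S ^ n.val

/-! ### The constants `B` and `C` -/

/-- The element `m ∈ {0, 1, …, (p-1)/2}` with `m ^ 2 = 2 a + 1/4` in `ℤ/p` (which exists and is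
unique for `a ∈ I_p`), as a residue class; `0` if there is none. -/
def rootM {p : ℕ} (a : ZMod p) : ZMod p :=
  open scoped Classical in
  if h : ∃ m : ℕ, m ≤ (p - 1) / 2 ∧ (m : ZMod p) ^ 2 = 2 * a + 4⁻¹ then
    ((Nat.find h : ℕ) : ZMod p) else 0

/-- The constants `B^a_s`. For `a = -1/8`, where `m = 0`, the two square roots `±m` coincide
and contribute a single term `1`. -/
def constB {p : ℕ} (η : ℂ) (a s : ZMod p) : ℂ :=
  open scoped Classical in
  if a ∉ Ip p then 0
  else if a = -8⁻¹ then 1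
  else pw η (rootM a * s) + pw η (-(rootM a * s))

/-- The constants `C^a_s`. -/
def constC {p : ℕ} (η : ℂ) (a s : ZMod p) : ℂ :=
  open scoped Classical in
  if a ∉ Ip p then 0
  else if a = 0 then
    (pw η (s - 2⁻¹) + pw η (-(s - 2⁻¹))) *
      (pw η (-2⁻¹ : ZMod p) - pw η (2⁻¹ : ZMod p))⁻¹
  else if a = -8⁻¹ then
    (pw η (2⁻¹ * (s - 2⁻¹)) + pw η (-(2⁻¹ * (s - 2⁻¹)))) *
      (pw η (-4⁻¹ : ZMod p) - pw η (4⁻¹ : ZMod p))⁻¹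
  else
    (pw η ((rootM a - 2⁻¹) * (s - 2⁻¹)) + pw η (-((rootM a - 2⁻¹) * (s - 2⁻¹)))) *
        (pw η (2⁻¹ * (rootM a - 2⁻¹)) - pw η (-(2⁻¹ * (rootM a - 2⁻¹))))⁻¹ -
      (pw η ((rootM a + 2⁻¹) * (s - 2⁻¹)) + pw η (-((rootM a + 2⁻¹) * (s - 2⁻¹)))) *
        (pw η (2⁻¹ * (rootM a + 2⁻¹)) - pw η (-(2⁻¹ * (rootM a + 2⁻¹))))⁻¹

end Braid

end

noncomputable section

namespace Braid

/-! ### Powers of a root of unity -/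

section Roots

variable {p : ℕ} [Fact p.Prime] {η : ℂ}

/-! Each `psiHat η l` has the form (1 + X) η^τ(Y), where Y is the action of x_l, Y^p = 1, X^2 = 0
and XY = ηYX (`psiHat_eq`, `twistX_mul_self`, `twistX_mul_twistY`). The last relation says that X
carries the η^i-eigenspace of Y into the η^(i-1)-eigenspace, so the operator is triangular with
diagonal entries η^τ(i). Since τ(i) - τ(i-1) = i, the two entries linked by X agree only for i = 0.
There a genuine Jordan block remains, and the unipotent part is 1 + X P_0, with P_0 the projection
onto the fixed space of Y. For i ≠ 0 the X-entry is removed by conjugating with 1 + X κ(Y), κ(i) =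
(1 - η^(-i))^(-1). The conjugated functional calculus is `twistHom`; its value at η^τ is the
semisimple part (`isMulJordan_twist`).

Because `twistHom` is an algebra homomorphism, Fourier inversion (`specProj_algHom`) turns the
projection Φ(·; a) into `twistHom` of the indicator of τ(i) = a. For odd labels Y is diagonal and
the formulas are immediate. For even labels Y is a translation, and character sums over the
solutions i = ±m - 1/2 of τ(i) = a produce B and C (`constB_eq`, `constC_eq`). The spectrum is read
off from the diagonal entries (`spectrum_twist`). -/

theorem pw_zero : pw η (0 : ZMod p) = 1 := by simp [pw]

theorem pw_one : pw η (1 : ZMod p) = η := by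
  have : Fact (1 < p) := ⟨(Fact.out : p.Prime).one_lt⟩
  simp [pw, ZMod.val_one]

theorem pw_mul_neg (hη : η ^ p = 1) (a : ZMod p) : pw η a * pw η (-a) = 1 := by
  rw [← pw_add hη, add_neg_cancel, pw_zero]

theorem pw_ne_zero (hη : η ^ p = 1) (a : ZMod p) : pw η a ≠ 0 :=
  left_ne_zero_of_mul_eq_one (pw_mul_neg hη a)

theorem pw_pow_val (hη : η ^ p = 1) (a n : ZMod p) : pw η a ^ n.val = pw η (a * n) := by
  rw [pw, pw, ← pow_mul, ZMod.val_mul, ← pow_mod_orderOf,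
    ← Nat.mod_mod_of_dvd (a.val * n.val) (orderOf_dvd_of_pow_eq_one hη), pow_mod_orderOf]

theorem pw_inj (hη : IsPrimitiveRoot η p) {a b : ZMod p} : pw η a = pw η b ↔ a = b :=
  ⟨fun h => ZMod.val_injective p (hη.pow_inj (ZMod.val_lt a) (ZMod.val_lt b) h), fun h => h ▸ rfl⟩

theorem pw_eq_one_iff (hη : IsPrimitiveRoot η p) {a : ZMod p} : pw η a = 1 ↔ a = 0 := by
  rw [← pw_inj hη, pw_zero]

theorem sum_pw_mul (hη : IsPrimitiveRoot η p) (a : ZMod p) :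
    ∑ n : ZMod p, pw η (a * n) = if a = 0 then (p : ℂ) else 0 := by
  split_ifs with h
  · simp [h, pw_zero, ZMod.card]
  · have h1 : pw η a * ∑ n : ZMod p, pw η (a * n) = ∑ n : ZMod p, pw η (a * n) := by
      rw [Finset.mul_sum, ← Equiv.sum_comp (Equiv.addRight (1 : ZMod p)) fun n => pw η (a * n)]
      refine Finset.sum_congr rfl fun n _ => ?_
      rw [← pw_add hη.pow_eq_one, Equiv.coe_addRight, mul_add, mul_one, add_comm]
    by_contra h2
    exact h ((pw_eq_one_iff hη).1 (mul_right_cancel₀ h2 (by rw [h1, one_mul])))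

end Roots

/-! ### Spectral projections of an operator of order `p` -/

section Projections

variable {p : ℕ} [Fact p.Prime] {η : ℂ} {M : Type*} [AddCommGroup M] [Module ℂ M]
  {Y : Module.End ℂ M}

/-- The wrap-around of `val` modulo p is harmless because the order of Y divides p. -/
theorem pow_val_add (hY : Y ^ p = 1) (m n : ZMod p) :
    Y ^ (m + n).val = Y ^ m.val * Y ^ n.val := by
  rw [← pow_add, ZMod.val_add, ← pow_mod_orderOf,
    Nat.mod_mod_of_dvd _ (orderOf_dvd_of_pow_eq_one hY), pow_mod_orderOf]

theorem pow_val_one : Y ^ (1 : ZMod p).val = Y := by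
  have : Fact (1 < p) := ⟨(Fact.out : p.Prime).one_lt⟩
  rw [ZMod.val_one, pow_one]

theorem mul_specProj (hη : η ^ p = 1) (hY : Y ^ p = 1) (a : ZMod p) :
    Y * specProj η Y a = pw η a • specProj η Y a := by
  rw [specProj, mul_smul_comm, smul_comm (pw η a)]
  congr 1
  rw [Finset.mul_sum, Finset.smul_sum]
  rw [← Equiv.sum_comp (Equiv.addRight (1 : ZMod p)) fun n => pw η a • pw η (-(a * n)) • Y ^ n.val]
  refine Finset.sum_congr rfl fun n _ => ?_
  rw [Equiv.coe_addRight, smul_smul, ← pw_add hη]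
  beta_reduce
  rw [add_comm n, pow_val_add hY, pow_val_one, mul_smul_comm]
  congr 2
  ring

theorem specProj_apply_of_mem (hη : IsPrimitiveRoot η p) (a b : ZMod p) {v : M}
    (hv : v ∈ Module.End.eigenspace Y (pw η b)) :
    specProj η Y a v = if a = b then v else 0 := by
  have hv := Module.End.mem_eigenspace_iff.1 hv
  have hpow : ∀ n : ℕ, (Y ^ n) v = pw η b ^ n • v := by
    intro n
    induction n with
    | zero => simp
    | succ n ih => rw [pow_succ, Module.End.mul_apply, hv, map_smul, ih, smul_smul, pow_succ,
        mul_comm]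
  rw [specProj, LinearMap.smul_apply, LinearMap.sum_apply]
  simp_rw [LinearMap.smul_apply, hpow, pw_pow_val hη.pow_eq_one, smul_smul,
    ← pw_add hη.pow_eq_one]
  have : ∀ n : ZMod p, -(a * n) + b * n = (b - a) * n := fun n => by ring
  simp_rw [this]
  rw [← Finset.sum_smul, sum_pw_mul hη, smul_smul]
  by_cases h : a = b
  · simp [h]
  · simp [h, sub_eq_zero, Ne.symm h]

theorem specProj_of_mul_eq (hη : IsPrimitiveRoot η p) (a b : ZMod p) {Z : Module.End ℂ M}
    (hZ : Y * Z = pw η b • Z) : specProj η Y a * Z = if a = b then Z else 0 := by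
  ext v
  rw [Module.End.mul_apply, specProj_apply_of_mem hη a b
    (Module.End.mem_eigenspace_iff.2 (LinearMap.congr_fun hZ v))]
  split_ifs <;> rfl

theorem specProj_mul_specProj (hη : IsPrimitiveRoot η p) (hY : Y ^ p = 1) (a b : ZMod p) :
    specProj η Y a * specProj η Y b = if a = b then specProj η Y b else 0 :=
  specProj_of_mul_eq hη a b (mul_specProj hη.pow_eq_one hY b)

theorem sum_specProj (hη : IsPrimitiveRoot η p) : ∑ a : ZMod p, specProj η Y a = 1 := by
  simp_rw [specProj]
  rw [← Finset.smul_sum, Finset.sum_comm]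
  simp_rw [← Finset.sum_smul]
  have : ∀ n a : ZMod p, -(a * n) = (-n) * a := fun n a => by ring
  simp_rw [this, sum_pw_mul hη]
  simp [smul_smul]

theorem specProj_apply_mem (hη : η ^ p = 1) (hY : Y ^ p = 1) (a : ZMod p) (v : M) :
    specProj η Y a v ∈ Module.End.eigenspace Y (pw η a) := by
  rw [Module.End.mem_eigenspace_iff, ← Module.End.mul_apply, mul_specProj hη hY,
    LinearMap.smul_apply]

theorem isProj_specProj (hη : IsPrimitiveRoot η p) (hY : Y ^ p = 1) (a : ZMod p) :
    LinearMap.IsProj (Module.End.eigenspace Y (pw η a)) (specProj η Y a) where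
  map_mem := specProj_apply_mem hη.pow_eq_one hY a
  map_id v hv := by rw [specProj_apply_of_mem hη a a hv, if_pos rfl]

theorem ker_specProj (hη : IsPrimitiveRoot η p) (hY : Y ^ p = 1) (a : ZMod p) :
    LinearMap.ker (specProj η Y a) =
      ⨆ b : ZMod p, ⨆ _ : b ≠ a, Module.End.eigenspace Y (pw η b) := by
  apply le_antisymm
  · intro v hv
    -- The projections sum to 1; the term b = a vanishes on the kernel, and the others lie in the
    -- remaining eigenspaces.
    have h : v = ∑ b : ZMod p, specProj η Y b v := by
      rw [← LinearMap.sum_apply, sum_specProj hη, Module.End.one_apply]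
    rw [h]
    refine Submodule.sum_mem _ fun b _ => ?_
    by_cases hb : b = a
    · rw [hb, LinearMap.mem_ker.1 hv]
      exact Submodule.zero_mem _
    · exact Submodule.mem_iSup_of_mem b (Submodule.mem_iSup_of_mem hb
        (specProj_apply_mem hη.pow_eq_one hY b v))
  · refine iSup₂_le fun b hb v hv => ?_
    rw [LinearMap.mem_ker, specProj_apply_of_mem hη a b hv, if_neg hb.symm]

/-- The functional calculus `f ↦ ∑ i, f i • P_i`, with `P_i` the spectral projections of an
operator `Y` with `Y ^ p = 1`. -/
def specHom (hη : IsPrimitiveRoot η p) (hY : Y ^ p = 1) : (ZMod p → ℂ) →ₐ[ℂ] Module.End ℂ M :=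
  AlgHom.ofLinearMap (Fintype.linearCombination ℂ (specProj η Y))
    (by simp [Fintype.linearCombination_apply, sum_specProj hη])
    (by
      intro f h
      simp [Fintype.linearCombination_apply, Finset.sum_mul_sum, specProj_mul_specProj hη hY,
        smul_smul, mul_comm])

theorem specHom_apply (hη : IsPrimitiveRoot η p) (hY : Y ^ p = 1) (f : ZMod p → ℂ) :
    specHom hη hY f = ∑ i, f i • specProj η Y i := rfl

theorem specHom_single (hη : IsPrimitiveRoot η p) (hY : Y ^ p = 1) (a : ZMod p) :
    specHom hη hY (fun i => if i = a then 1 else 0) = specProj η Y a := by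
  simp [specHom_apply]

/-- Fourier inversion for functions on `ℤ/p` with values in the `p`-th roots of unity. -/
theorem specProj_algHom (hη : IsPrimitiveRoot η p) (G : (ZMod p → ℂ) →ₐ[ℂ] Module.End ℂ M)
    (t : ZMod p → ZMod p) (a : ZMod p) :
    specProj η (G fun i => pw η (t i)) a = G fun i => if a = t i then 1 else 0 := by
  simp_rw [specProj, ← map_pow, ← map_smul]
  rw [← map_sum, ← map_smul]
  congr 1
  funext i
  simp only [Pi.smul_apply, Finset.sum_apply, Pi.pow_apply, smul_eq_mul,
    pw_pow_val hη.pow_eq_one, ← pw_add hη.pow_eq_one]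
  have : ∀ n : ZMod p, -(a * n) + t i * n = (t i - a) * n := fun n => by ring
  simp_rw [this, sum_pw_mul hη, sub_eq_zero, eq_comm (a := a)]
  split_ifs <;> simp

end Projections

/-! ### Twisted pairs -/

section Twist

variable {p : ℕ} [Fact p.Prime] {η : ℂ} {M : Type*} [AddCommGroup M] [Module ℂ M]
  {X Y : Module.End ℂ M}

theorem mul_pow_of_twist (hXY : X * Y = η • (Y * X)) (n : ℕ) :
    X * Y ^ n = η ^ n • (Y ^ n * X) := by
  induction n with
  | zero => simp
  | succ n ih => rw [pow_succ, ← mul_assoc, ih, smul_mul_assoc, mul_assoc, hXY, mul_smul_comm,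
      smul_smul, ← mul_assoc, pow_succ]

/-- The twist makes X lower the exponent of the Y-eigenvalue by one: moving X past Y^n costs η^n,
which shifts the character in `specProj`. -/
theorem mul_specProj_of_twist (hη : η ^ p = 1) (hXY : X * Y = η • (Y * X)) (i : ZMod p) :
    X * specProj η Y i = specProj η Y (i - 1) * X := by
  simp_rw [specProj, mul_smul_comm, smul_mul_assoc, Finset.mul_sum, Finset.sum_mul,
    mul_smul_comm, smul_mul_assoc, mul_pow_of_twist hXY, smul_smul]
  congr 1
  refine Finset.sum_congr rfl fun n _ => ?_
  rw [show η ^ n.val = pw η n from rfl, ← pw_add hη]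
  congr 2
  ring

theorem specHom_mul_of_twist (hη : IsPrimitiveRoot η p) (hY : Y ^ p = 1)
    (hXY : X * Y = η • (Y * X)) (f : ZMod p → ℂ) :
    specHom hη hY f * X = X * specHom hη hY fun i => f (i - 1) := by
  rw [specHom_apply, specHom_apply, Finset.sum_mul, Finset.mul_sum,
    ← Equiv.sum_comp (Equiv.subRight (1 : ZMod p)) fun i => f i • specProj η Y i * X]
  refine Finset.sum_congr rfl fun i _ => ?_
  rw [Equiv.subRight_apply, smul_mul_assoc, mul_smul_comm, mul_specProj_of_twist hη.pow_eq_one hXY]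

/-- All spectral projections of `Y` are nonzero if an invertible operator shifts them. -/
theorem specProj_ne_zero_of_twist [Nontrivial M] (hη : IsPrimitiveRoot η p) (hX : IsUnit X)
    (hXY : X * Y = η • (Y * X)) (i : ZMod p) : specProj η Y i ≠ 0 := by
  intro h
  -- As X is invertible, the vanishing of one projection passes to its neighbour, hence all the way
  -- round ℤ/p; but the projections sum to 1.
  have step : ∀ j : ZMod p, specProj η Y j = 0 → specProj η Y (j - 1) = 0 := by
    intro j hj
    have := mul_specProj_of_twist hη.pow_eq_one hXY j
    rw [hj, mul_zero] at this
    exact (hX.mul_left_eq_zero).1 this.symm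
  have all : ∀ n : ℕ, specProj η Y (i - (n : ZMod p)) = 0 := by
    intro n
    induction n with
    | zero => simpa using h
    | succ n ih => simpa [sub_sub] using step _ ih
  have := sum_specProj (Y := Y) hη
  rw [Finset.sum_eq_zero fun a _ => ?_] at this
  · exact zero_ne_one this
  · simpa using all (i - a).val

/-- The factors `(1 - η ^ (-i))⁻¹`. -/
def kappa (η : ℂ) (i : ZMod p) : ℂ := (1 - pw η (-i))⁻¹

/-- The functional calculus of the conjugate of `Y` that diagonalises the semisimple part of
`(1 + X) f(Y)`. -/
def twistHom (hη : IsPrimitiveRoot η p) (hY : Y ^ p = 1) (hX : X * X = 0)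
    (hXY : X * Y = η • (Y * X)) : (ZMod p → ℂ) →ₐ[ℂ] Module.End ℂ M :=
  AlgHom.ofLinearMap
    { toFun := fun f => specHom hη hY f +
        X * specHom hη hY fun i => kappa η i * (f i - f (i - 1))
      map_add' := by
        intro f h
        have : (fun i => kappa η i * ((f + h) i - (f + h) (i - 1))) =
          (fun i => kappa η i * (f i - f (i - 1))) + fun i => kappa η i * (h i - h (i - 1)) := by
          funext i
          simp only [Pi.add_apply]
          ring
        rw [this, map_add, map_add, mul_add]
        abel
      map_smul' := by
        intro c f
        have : (fun i => kappa η i * ((c • f) i - (c • f) (i - 1))) =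
          c • (fun i => kappa η i * (f i - f (i - 1))) := by
          funext i
          simp only [Pi.smul_apply, smul_eq_mul]
          ring
        rw [this, map_smul, map_smul, mul_smul_comm, smul_add, RingHom.id_apply] }
    (by
      change specHom hη hY 1 + X * specHom hη hY (fun i => kappa η i * (1 - 1)) = 1
      have : (fun i : ZMod p => kappa η i * (1 - 1)) = 0 := by
        funext i
        simp
      rw [this, map_one, map_zero, mul_zero, add_zero])
    (by
      intro f h
      -- The correction f ↦ κ(i)(f(i) - f(i-1)) is a twisted derivation. Its Leibniz rule matches
      -- the shift that f(Y) undergoes when it passes X, and the term with two factors X vanishes.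
      have : (fun i => kappa η i * ((f * h) i - (f * h) (i - 1))) =
          (fun i => kappa η i * (f i - f (i - 1))) * h +
          (fun i => f (i - 1)) * fun i => kappa η i * (h i - h (i - 1)) := by
        funext i
        simp only [Pi.add_apply, Pi.mul_apply]
        ring
      simp only [LinearMap.coe_mk, AddHom.coe_mk]
      have h1 (Z : Module.End ℂ M) :
          specHom hη hY f * (X * Z) = X * ((specHom hη hY fun i => f (i - 1)) * Z) := by
        rw [← mul_assoc, specHom_mul_of_twist hη hY hXY, mul_assoc]
      have h2 (k : ZMod p → ℂ) (Z : Module.End ℂ M) : X * specHom hη hY k * (X * Z) = 0 := by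
        rw [← mul_assoc, mul_assoc X, specHom_mul_of_twist hη hY hXY, ← mul_assoc X, hX, zero_mul,
          zero_mul]
      rw [this, map_mul, map_add, map_mul, map_mul, mul_add X, add_mul, mul_add (specHom hη hY f),
        mul_add (X * _), h1, h2, mul_assoc X]
      abel)

theorem twistHom_apply (hη : IsPrimitiveRoot η p) (hY : Y ^ p = 1) (hX : X * X = 0)
    (hXY : X * Y = η • (Y * X)) (f : ZMod p → ℂ) :
    twistHom hη hY hX hXY f = specHom hη hY f +
        X * specHom hη hY fun i => kappa η i * (f i - f (i - 1)) := rfl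

end Twist

/-! ### Multiplicative Jordan decompositions -/

section Jordan

variable {p : ℕ} [Fact p.Prime] {η : ℂ} {M : Type*} [AddCommGroup M] [Module ℂ M]
  {A S T S' T' X Y : Module.End ℂ M}

/-- A = S + S(T - 1) is an additive Jordan decomposition, which is unique; cancelling the invertible
S then recovers T. -/
theorem IsMulJordan.unique [FiniteDimensional ℂ M] (h : IsMulJordan A S T)
    (h' : IsMulJordan A S' T') (hS : IsUnit S) : S' = S ∧ T' = T := by
  have key : ∀ {S T : Module.End ℂ M}, IsMulJordan A S T →
      IsNilpotent (S * (T - 1)) ∧ Commute (S * (T - 1)) S ∧ S * (T - 1) + S = A := by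
    intro S T h
    have hc : Commute S (T - 1) := h.commute.sub_right (Commute.one_right S)
    refine ⟨hc.isNilpotent_mul_left h.unipotent, (Commute.refl S).mul_left hc.symm, ?_⟩
    rw [h.eq_mul, mul_sub, mul_one, sub_add_cancel]
  obtain ⟨n, c, e⟩ := key h
  obtain ⟨n', c', e'⟩ := key h'
  obtain rfl := (Module.End.isNilpotent_isSemisimple_unique n' h'.semisimple n h.semisimple c' c
    (e'.trans e.symm)).2
  exact ⟨rfl, hS.mul_left_cancel (h'.eq_mul.symm.trans h.eq_mul)⟩

theorem isSemisimple_of_pow_eq_one [FiniteDimensional ℂ M] {n : ℕ} (hn : n ≠ 0)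
    (h : S ^ n = 1) : S.IsSemisimple := by
  refine Module.End.isSemisimple_of_squarefree_aeval_eq_zero
    (p := (Polynomial.X ^ n - 1 : Polynomial ℂ)) ?_ (by simp [h])
  exact (Polynomial.X_pow_sub_one_separable_iff.2 (Nat.cast_ne_zero.2 hn)).squarefree

theorem two_ne_zero_zmod (hp : p ≠ 2) : (2 : ZMod p) ≠ 0 := by
  intro h
  have h2 : ((2 : ℕ) : ZMod p) = 0 := by exact_mod_cast h
  exact hp ((Nat.prime_dvd_prime_iff_eq Fact.out Nat.prime_two).1
    ((ZMod.natCast_eq_zero_iff 2 p).1 h2))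

theorem tau_sub_one (hp : p ≠ 2) (i : ZMod p) : tau i = tau (i - 1) + i := by
  have h2 := two_ne_zero_zmod hp
  simp only [tau]
  field_simp
  ring

/-- This identity dictates the choice of κ: off i = 0 the correction reproduces exactly the X-entry
of (1 + X) η^τ(Y). At i = 0 the convention 0⁻¹ = 0 gives κ = 0. -/
theorem kappa_mul_tau (hp : p ≠ 2) (hη : IsPrimitiveRoot η p) (i : ZMod p) :
    kappa η i * (pw η (tau i) - pw η (tau (i - 1))) =
      pw η (tau i) * (1 - if i = 0 then 1 else 0) := by
  split_ifs with h
  · simp [kappa, h, pw_zero]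
  · have h1 : 1 - pw η (-i) ≠ 0 := by
      rw [sub_ne_zero, ne_comm, Ne, pw_eq_one_iff hη, neg_eq_zero]
      exact h
    have h2 : tau (i - 1) = tau i + -i := by
      rw [tau_sub_one hp i]
      ring
    rw [h2, pw_add hη.pow_eq_one, kappa]
    field_simp
    ring

theorem twistHom_tau_pow (hη : IsPrimitiveRoot η p)
    (hY : Y ^ p = 1) (hX : X * X = 0) (hXY : X * Y = η • (Y * X)) :
    (twistHom hη hY hX hXY fun i => pw η (tau i)) ^ p = 1 := by
  rw [← map_pow, ← map_one (twistHom hη hY hX hXY)]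
  congr 1
  funext i
  rw [Pi.pow_apply, pw, ← pow_mul, mul_comm, pow_mul, hη.pow_eq_one, one_pow, Pi.one_apply]

/-- The explicit Jordan decomposition of `(1 + X) η ^ τ(Y)`. -/
theorem isMulJordan_twist [FiniteDimensional ℂ M] (hp : p ≠ 2) (hη : IsPrimitiveRoot η p)
    (hY : Y ^ p = 1) (hX : X * X = 0) (hXY : X * Y = η • (Y * X)) :
    IsMulJordan ((1 + X) * specHom hη hY fun i => pw η (tau i))
      (twistHom hη hY hX hXY fun i => pw η (tau i)) (1 + X * specProj η Y (0 : ZMod p)) := by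
  set D := specHom hη hY fun i => pw η (tau i) with hD
  set P := specProj η Y (0 : ZMod p) with hP
  have hP' : P = specHom hη hY fun i => if i = 0 then 1 else 0 := (specHom_single hη hY 0).symm
  -- Any function of Y between two factors X can be moved out with a shift, so X^2 = 0 kills the
  -- product.
  have hPX (Z : Module.End ℂ M) : X * (P * (X * Z)) = 0 := by
    rw [← mul_assoc P, hP', specHom_mul_of_twist hη hY hXY, ← mul_assoc X, ← mul_assoc X, hX,
      zero_mul, zero_mul]
  have hDX (Z : Module.End ℂ M) : X * (D * (X * Z)) = 0 := by
    rw [← mul_assoc D, hD, specHom_mul_of_twist hη hY hXY, ← mul_assoc X, ← mul_assoc X, hX,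
      zero_mul, zero_mul]
  have hPD : P * D = P := by
    rw [hP', hD, ← map_mul]
    congr 1
    funext i
    by_cases h : i = 0 <;> simp [h, tau, pw_zero]
  -- X P takes values in the η^(-1)-eigenspace of Y, where D is also the identity because τ(-1) = 0
  -- = τ(0).
  have hDXP : D * (X * P) = X * P := by
    rw [← mul_assoc, hD, specHom_mul_of_twist hη hY hXY, hP', mul_assoc, ← map_mul]
    congr 2
    funext i
    by_cases h : i = 0 <;> simp [h, tau, pw_zero]
  have hS : (twistHom hη hY hX hXY fun i => pw η (tau i)) = D + X * (D - P) := by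
    rw [twistHom_apply, ← hD, hP', hD, ← map_sub]
    congr 3
    funext i
    rw [kappa_mul_tau hp hη, Pi.sub_apply]
    by_cases h : i = 0 <;> simp [h, tau, pw_zero]
  have hST : (D + X * (D - P)) * (1 + X * P) = (1 + X) * D := by
    have h0 : X * (D - P) * (X * P) = 0 := by
      rw [mul_assoc, sub_mul, mul_sub, hDX, hPX, sub_zero]
    rw [mul_add, mul_one, add_mul D, hDXP, h0, mul_sub, add_mul, one_mul]
    abel
  have hTS : (1 + X * P) * (D + X * (D - P)) = (1 + X) * D := by
    rw [add_mul, one_mul, mul_add (X * P), mul_assoc X P D, hPD, mul_assoc X P, hPX, mul_sub,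
      add_mul, one_mul]
    abel
  refine ⟨isSemisimple_of_pow_eq_one (Fact.out : p.Prime).ne_zero
    (twistHom_tau_pow hη hY hX hXY), ⟨2, ?_⟩, ?_, ?_⟩
  · rw [add_sub_cancel_left, pow_two, mul_assoc, hPX]
  · rw [hS]
    exact hST.trans hTS.symm
  · rw [hS, hST]

/-- A - z is S - z plus the commuting nilpotent S(T - 1), so it is invertible when S - z is.
Conversely, X-null vectors in the Y-eigenspaces are eigenvectors of A. -/
theorem spectrum_twist [FiniteDimensional ℂ M] (hp : p ≠ 2) (hη : IsPrimitiveRoot η p)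
    (hY : Y ^ p = 1) (hX : X * X = 0) (hXY : X * Y = η • (Y * X))
    (hv : ∀ i : ZMod p, ∃ v : M, v ≠ 0 ∧ specProj η Y i v = v ∧ X v = 0) :
    spectrum ℂ ((1 + X) * specHom hη hY fun i => pw η (tau i)) =
      {z : ℂ | ∃ a ∈ Ip p, z = pw η a} := by
  ext z
  constructor
  · contrapose!
    intro hz
    have hJ := isMulJordan_twist hp hη hY hX hXY
    rw [spectrum.mem_iff, not_not, ← IsUnit.neg_iff, neg_sub, hJ.eq_mul]
    set S := twistHom hη hY hX hXY fun i => pw η (tau i) with hS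
    set T := 1 + X * specProj η Y (0 : ZMod p)
    have hc : Commute S (T - 1) := hJ.commute.sub_right (Commute.one_right S)
    have hu : IsUnit (S - algebraMap ℂ _ z) := by
      -- S - z is the image of the function η^τ(i) - z, which is invertible as soon as it has no
      -- zero.
      rw [hS, ← AlgHom.commutes (twistHom hη hY hX hXY), ← map_sub]
      refine IsUnit.map _ (Pi.isUnit_iff.2 fun i => isUnit_iff_ne_zero.2 ?_)
      refine sub_ne_zero.2 fun h => hz ⟨tau i, ⟨i, rfl⟩, h.symm⟩
    have : S * T - algebraMap ℂ _ z = S * (T - 1) + (S - algebraMap ℂ _ z) := by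
      rw [mul_sub, mul_one]
      abel
    rw [this]
    refine (hc.isNilpotent_mul_left hJ.unipotent).isUnit_add_right_of_commute hu ?_
    exact (((Commute.refl S).mul_left hc.symm).sub_right
      (Algebra.commutes z (S * (T - 1))).symm)
  · rintro ⟨_, ⟨i, rfl⟩, rfl⟩
    obtain ⟨v, hv0, hPv, hXv⟩ := hv i
    have hD : specHom hη hY (fun i => pw η (tau i)) v = pw η (tau i) • v := by
      rw [← hPv, ← Module.End.mul_apply, ← specHom_single hη hY, ← map_mul, ← LinearMap.smul_apply,
        ← map_smul]
      congr 2
      funext j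
      by_cases h : j = i <;> simp [h]
    refine (Module.End.hasEigenvalue_of_hasEigenvector (x := v)
      ⟨Module.End.mem_eigenspace_iff.2 ?_, hv0⟩).mem_spectrum
    rw [Module.End.mul_apply, hD, map_smul, LinearMap.add_apply, hXv, add_zero,
      Module.End.one_apply]

end Jordan

/-! ### Operators on tensor products -/

section Tensor

variable {p : ℕ} [Fact p.Prime] {η : ℂ} {M N : Type*} [AddCommGroup M] [Module ℂ M]
  [AddCommGroup N] [Module ℂ N] {y w : Module.End ℂ M} {n : Module.End ℂ N}

theorem specProj_rTensor (a : ZMod p) :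
    specProj η (y.rTensor N) a = (specProj η y a).rTensor N := by
  have h : ∀ z : Module.End ℂ M, z.rTensor N = Module.End.rTensorAlgHom ℂ M N z := fun _ => rfl
  simp only [specProj, h, map_smul, map_sum, map_pow]

theorem rTensor_pow_eq_one {m : ℕ} (hy : y ^ m = 1) : (y.rTensor N) ^ m = 1 := by
  have h : ∀ z : Module.End ℂ M, z.rTensor N = Module.End.rTensorAlgHom ℂ M N z := fun _ => rfl
  rw [h, ← map_pow, hy, map_one]

theorem specHom_rTensor (hη : IsPrimitiveRoot η p) (hy : y ^ p = 1)
    (hY : (y.rTensor N) ^ p = 1) (f : ZMod p → ℂ) :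
    specHom hη hY f = (specHom hη hy f).rTensor N := by
  have h : ∀ z : Module.End ℂ M, z.rTensor N = Module.End.rTensorAlgHom ℂ M N z := fun _ => rfl
  simp only [specHom_apply, specProj_rTensor]
  simp only [h, map_smul, map_sum]

theorem map_mul_rTensor_of_twist (h : w * y = η • (y * w)) :
    TensorProduct.map w n * y.rTensor N = η • (y.rTensor N * TensorProduct.map w n) := by
  rw [LinearMap.rTensor, ← TensorProduct.map_mul, ← TensorProduct.map_mul, h,
    TensorProduct.map_smul_left]
  rfl

theorem map_mul_self_of_sq_eq_zero (h : n * n = 0) :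
    TensorProduct.map w n * TensorProduct.map w n = 0 := by
  rw [← TensorProduct.map_mul, h, TensorProduct.map_zero_right]

end Tensor

/-! ### The operators on `V` -/

section Operators

variable {p g : ℕ} [Fact p.Prime] {η : ℂ}

theorem end_ext {A B : Module.End ℂ (V p g)} (h : ∀ j, A (e j) = B (e j)) : A = B := by
  refine (Pi.basisFun ℂ (MultiIndex p g)).ext fun j => ?_
  have hj : Pi.basisFun ℂ (MultiIndex p g) j = e j := by simp [e, Pi.basisFun_apply]
  rw [hj, h]

theorem letter_inl (k : Fin g) (j : MultiIndex p g) :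
    letter η (Sum.inl k, 1) (e j) = pw η (j k) • e j := by
  simp [letter, onBasis_e]

theorem letter_inr (k : Fin g) (j : MultiIndex p g) :
    letter η (Sum.inr k, 1) (e j) = e (j + (re p g (k + 1) - re p g k)) := by
  simp [letter, onBasis_e]

theorem letter_inr_pow (k : Fin g) (n : ℕ) (j : MultiIndex p g) :
    (letter η (Sum.inr k, 1) ^ n) (e j) =
      e (j + (n : ZMod p) • (re p g (k + 1) - re p g k)) := by
  induction n with
  | zero => simp
  | succ n ih =>
    rw [pow_succ', Module.End.mul_apply, ih, letter_inr, Nat.cast_succ, add_smul, one_smul,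
      add_assoc]

theorem letter_pow_eq_one (hη : η ^ p = 1) (l : Label g) :
    (letter (p := p) η (l, 1)) ^ p = 1 := by
  refine end_ext fun j => ?_
  rcases l with k | k
  · have h (n : ℕ) : (letter η (Sum.inl k, 1) ^ n) (e j) = pw η (j k) ^ n • e j := by
      induction n with
      | zero => simp
      | succ n ih =>
        rw [pow_succ', Module.End.mul_apply, ih, map_smul, letter_inl, smul_smul, pow_succ]
    rw [h, pw, ← pow_mul, mul_comm, pow_mul, hη, one_pow, one_smul, Module.End.one_apply]
  · rw [letter_inr_pow, CharP.cast_eq_zero, zero_smul, add_zero, Module.End.one_apply]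

theorem specHom_inl (hη : IsPrimitiveRoot η p) (k : Fin g) (f : ZMod p → ℂ)
    (j : MultiIndex p g) :
    specHom hη (letter_pow_eq_one hη.pow_eq_one (Sum.inl k)) f (e j) = f (j k) • e j := by
  have h (i : ZMod p) : specProj η (letter (p := p) η (Sum.inl k, 1)) i (e j) =
      if i = j k then e j else 0 :=
    specProj_apply_of_mem hη i (j k) (Module.End.mem_eigenspace_iff.2 (letter_inl k j))
  simp [specHom_apply, LinearMap.sum_apply, h]

theorem specHom_inr (hη : IsPrimitiveRoot η p) (k : Fin g) (f : ZMod p → ℂ)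
    (j : MultiIndex p g) :
    specHom hη (letter_pow_eq_one hη.pow_eq_one (Sum.inr k)) f (e j) =
      (p : ℂ)⁻¹ • ∑ s : ZMod p, (∑ i, f i * pw η (i * s)) •
        e (j + s • (re p g k - re p g (k + 1))) := by
  simp only [specHom_apply, specProj, LinearMap.sum_apply, LinearMap.smul_apply, letter_inr_pow,
    ZMod.natCast_zmod_val, Finset.sum_smul, Finset.smul_sum, smul_smul]
  -- The letter x_{2k} translates by the negative of re k - re (k + 1), hence the substitution s ↦
  -- -s.
  rw [Finset.sum_comm, ← Equiv.sum_comp (Equiv.neg (ZMod p))]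
  refine Finset.sum_congr rfl fun s _ => Finset.sum_congr rfl fun i _ => ?_
  rw [Equiv.neg_apply, mul_neg, neg_neg, neg_smul, ← smul_neg, neg_sub]
  congr 1
  ring

theorem psi_inl (hη : IsPrimitiveRoot η p) (k : Fin g) :
    psi η (Sum.inl k) = specHom hη (letter_pow_eq_one (g := g) hη.pow_eq_one (Sum.inl k))
      fun i => pw η (tau i) :=
  end_ext fun j => by rw [specHom_inl, psi, onBasis_e]

/-- Completing the square: i(i+1)/2 + is = (i + s + 1/2)^2/2 - (s + 1/2)^2/2. -/
theorem sum_pw_tau (hp : p ≠ 2) (hη : IsPrimitiveRoot η p) (s : ZMod p) :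
    ∑ i : ZMod p, pw η (tau i) * pw η (i * s) =
      gauss η (2⁻¹ : ZMod p) * pw η (-(2⁻¹ * (s + 2⁻¹) ^ 2)) := by
  have h2 := two_ne_zero_zmod hp
  rw [gauss, Finset.sum_mul, ← Equiv.sum_comp (Equiv.addRight (s + 2⁻¹))
    fun t => pw η (2⁻¹ * t ^ 2) * _]
  refine Finset.sum_congr rfl fun i _ => ?_
  rw [← pw_add hη.pow_eq_one, ← pw_add hη.pow_eq_one, Equiv.coe_addRight, tau]
  congr 1
  field_simp
  ring

theorem psi_inr (hp : p ≠ 2) (hη : IsPrimitiveRoot η p) (k : Fin g) :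
    psi η (Sum.inr k) = specHom hη (letter_pow_eq_one (g := g) hη.pow_eq_one (Sum.inr k))
      fun i => pw η (tau i) := by
  refine end_ext fun j => ?_
  rw [specHom_inr, psi, onBasis_e, div_eq_inv_mul, mul_smul, Finset.smul_sum]
  simp_rw [sum_pw_tau hp hη, smul_smul]

/-! ### Words -/

theorem rightAct_append (w₁ w₂ : List (Label g × ℤ)) :
    rightAct (p := p) η (w₁ ++ w₂) = rightAct η w₂ * rightAct η w₁ := by
  simp [rightAct]

theorem rightAct_cons (x : Label g × ℤ) (w : List (Label g × ℤ)) :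
    rightAct (p := p) η (x :: w) = rightAct η w * letter η x := by
  simp [rightAct]

theorem rightAct_map_inl (hη : η ^ p = 1) (l : List (Fin g)) (j : MultiIndex p g) :
    rightAct η (l.map fun r => ((Sum.inl r : Label g), (1 : ℤ))) (e j) =
      pw η (l.map j).sum • e j := by
  induction l with
  | nil => simp [rightAct, pw_zero]
  | cons r l ih =>
    rw [List.map_cons, rightAct_cons, Module.End.mul_apply, letter_inl, map_smul, ih, smul_smul,
      List.map_cons, List.sum_cons, pw_add hη]

theorem rightAct_map_inr (l : List (Fin g)) (j : MultiIndex p g) :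
    rightAct η (l.map fun r => ((Sum.inr r : Label g), (1 : ℤ))) (e j) =
      e (j + (l.map fun r : Fin g => re p g (r + 1) - re p g r).sum) := by
  induction l generalizing j with
  | nil => simp [rightAct]
  | cons r l ih =>
    rw [List.map_cons, rightAct_cons, Module.End.mul_apply, letter_inr, ih, List.map_cons,
      List.sum_cons, add_assoc]

theorem sum_filter_finRange {A : Type*} [AddCommMonoid A] (q : Fin g → Prop) [DecidablePred q]
    (f : Fin g → A) :
    (((List.finRange g).filter q).map f).sum = ∑ r with q r, f r := by
  rw [← List.sum_toFinset f ((List.nodup_finRange g).filter _)]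
  refine Finset.sum_congr ?_ fun _ _ => rfl
  ext r
  simp

theorem re_self (k : Fin g) : re p g k k = 1 := by simp [re]

/-- The translations by x_{2k}, …, x_{2g} telescope, and the upper end vanishes because `re p g g =
0`. -/
theorem sum_re_tail (k : Fin g) :
    (((List.finRange g).filter (k ≤ ·)).map fun r : Fin g => re p g (r + 1) - re p g r).sum =
      -re p g k := by
  rw [sum_filter_finRange]
  have h := Finset.sum_Ico_sub (re p g) k.2.le
  have hg : re p g g = 0 := by
    funext i
    simp [re, i.2.ne]
  rw [hg, zero_sub] at h
  rw [← h]
  refine Finset.sum_bij (fun r _ => (r : ℕ)) ?_ ?_ ?_ ?_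
  · intro r hr
    exact Finset.mem_Ico.2 ⟨Fin.le_def.1 (Finset.mem_filter.1 hr).2, r.2⟩
  · intro a _ b _ hab
    exact Fin.ext hab
  · intro b hb
    rw [Finset.mem_Ico] at hb
    exact ⟨⟨b, hb.2⟩, Finset.mem_filter.2 ⟨Finset.mem_univ _, Fin.le_def.2 hb.1⟩, rfl⟩
  · intro r _
    rfl

theorem rightAct_oddWord (hη : η ^ p = 1) (k : Fin g) (j : MultiIndex p g) :
    rightAct η (oddWord k) (e j) = pw η (∑ r ∈ Finset.Iio k, j r) • e (j - re p g k) := by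
  have : ∑ r ∈ Finset.Iio k, j r = (((List.finRange g).filter (· < k)).map j).sum := by
    rw [sum_filter_finRange]
    refine Finset.sum_congr ?_ fun _ _ => rfl
    ext r
    simp
  rw [oddWord, rightAct_append, Module.End.mul_apply, rightAct_map_inl hη, map_smul,
    rightAct_map_inr, sum_re_tail, this, sub_eq_add_neg]

theorem rightAct_evenWord (hη : η ^ p = 1) (k : Fin g) (j : MultiIndex p g) :
    rightAct η (evenWord k) (e j) = pw η (∑ r ∈ Finset.Iic k, j r) • e (j - re p g k) := by
  have : ∑ r ∈ Finset.Iic k, j r = (((List.finRange g).filter (· ≤ k)).map j).sum := by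
    rw [sum_filter_finRange]
    refine Finset.sum_congr ?_ fun _ _ => rfl
    ext r
    simp
  rw [evenWord, rightAct_append, Module.End.mul_apply, rightAct_map_inl hη, map_smul,
    rightAct_map_inr, sum_re_tail, this, sub_eq_add_neg]

theorem sum_Iic_re (k : Fin g) : ∑ r ∈ Finset.Iic k, re p g k r = 1 := by
  rw [Finset.sum_eq_single k (fun b _ hb => by simp [re, Fin.val_ne_of_ne hb]) (by simp), re_self]

theorem sum_Iic_re_succ (k : Fin g) : ∑ r ∈ Finset.Iic k, re p g (k + 1) r = 0 := by
  refine Finset.sum_eq_zero fun r hr => ?_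
  have : (r : ℕ) ≤ k := Fin.le_def.1 (Finset.mem_Iic.1 hr)
  rw [re, if_neg (by omega)]

theorem rightAct_evenWord_inv (hη : η ^ p = 1) (k : Fin g) (j : MultiIndex p g) :
    rightAct η (wordInv (evenWord k)) (e j) =
      pw η (-(∑ r ∈ Finset.Iic k, j r) - 1) • e (j + re p g k) := by
  -- The word sends e_{j + re k} to a multiple of e_j; the extra -1 in the phase is the contribution
  -- of re k to the sum over positions up to k.
  have h := LinearMap.congr_fun (rightAct_wordInv hη (evenWord k)) (e (j + re p g k))
  rw [Module.End.mul_apply, rightAct_evenWord hη, add_sub_cancel_right, map_smul,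
    Module.End.one_apply] at h
  simp only [Pi.add_apply, Finset.sum_add_distrib, sum_Iic_re] at h
  rw [← h, smul_smul, ← pw_add hη]
  simp [pw_zero]

theorem isUnit_rightAct (hη : η ^ p = 1) (w : List (Label g × ℤ)) :
    IsUnit (rightAct (p := p) η w) :=
  have h := rightAct_wordInv (p := p) hη w
  ⟨⟨_, _, mul_eq_one_comm.1 h, h⟩, rfl⟩

theorem isUnit_rightAct_wordInv (hη : η ^ p = 1) (w : List (Label g × ℤ)) :
    IsUnit (rightAct (p := p) η (wordInv w)) :=
  have h := rightAct_wordInv (p := p) hη w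
  ⟨⟨_, _, h, mul_eq_one_comm.1 h⟩, rfl⟩

theorem oddWord_twist (hη : η ^ p = 1) (k : Fin g) :
    rightAct (p := p) η (oddWord k) * letter η (Sum.inl k, 1) =
      η • (letter η (Sum.inl k, 1) * rightAct η (oddWord k)) := by
  refine end_ext fun j => ?_
  rw [LinearMap.smul_apply, Module.End.mul_apply, Module.End.mul_apply, letter_inl, map_smul,
    rightAct_oddWord hη, map_smul, letter_inl, smul_smul, smul_smul, smul_smul, Pi.sub_apply,
    re_self]
  congr 1
  nth_rw 3 [← pw_one (p := p) (η := η)]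
  simp only [← pw_add hη]
  congr 1
  ring

theorem evenWord_twist (hη : η ^ p = 1) (k : Fin g) :
    rightAct (p := p) η (wordInv (evenWord k)) * letter η (Sum.inr k, 1) =
      η • (letter η (Sum.inr k, 1) * rightAct η (wordInv (evenWord k))) := by
  refine end_ext fun j => ?_
  rw [LinearMap.smul_apply, Module.End.mul_apply, Module.End.mul_apply, letter_inr,
    rightAct_evenWord_inv hη, rightAct_evenWord_inv hη, map_smul, letter_inr, smul_smul,
    add_right_comm]
  congr 1
  nth_rw 2 [← pw_one (p := p) (η := η)]
  rw [← pw_add hη]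
  simp only [Pi.add_apply, Pi.sub_apply, Finset.sum_add_distrib, Finset.sum_sub_distrib,
    sum_Iic_re, sum_Iic_re_succ]
  congr 1
  ring

/-! ### The nilpotent operators on `U` -/

theorem sendTo_apply (l : Label g) (w v : U g) : sendTo l w v = v l • w := by
  simp [sendTo, Fintype.linearCombination_apply]

theorem sendTo_u (l m : Label g) (w : U g) : sendTo l w (u m) = if m = l then w else 0 := by
  by_cases h : m = l
  · simp [sendTo_apply, u, h]
  · simp [sendTo_apply, u, h, Ne.symm h]

theorem sendTo_mul_self {l : Label g} {w : U g} (h : w l = 0) : sendTo l w * sendTo l w = 0 := by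
  refine LinearMap.ext fun v => ?_
  simp [Module.End.mul_apply, sendTo_apply, h]

theorem du_inl_inr (k m : Fin g) : du (Sum.inl k) (Sum.inr m) = 0 := by
  simp only [du]
  split_ifs <;> simp [u]

theorem du_inr_inl (k m : Fin g) : du (Sum.inr k) (Sum.inl m) = 0 := by
  simp only [du]
  split_ifs <;> simp [u]

end Operators

/-! ### The operators on `L` as twisted pairs -/

section Twisted

variable {p g : ℕ} [Fact p.Prime] {η : ℂ}

/-- The action of `x_l` on `L`. -/
def twistY (η : ℂ) (l : Label g) : Module.End ℂ (L p g) := (letter η (l, 1)).rTensor (U g)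

/-- The nilpotent operator `X` with `Ψ̂_l = (1 + X) (Ψ_l ⊗ 1)`. -/
def twistX (η : ℂ) : Label g → Module.End ℂ (L p g)
  | Sum.inl k => TensorProduct.map (-rightAct η (oddWord k)) (sendTo (Sum.inr k) (du (Sum.inl k)))
  | Sum.inr k => TensorProduct.map (rightAct η (wordInv (evenWord k)))
      (sendTo (Sum.inl k) (du (Sum.inr k)))

theorem twistY_pow (hη : η ^ p = 1) (l : Label g) : (twistY (p := p) η l) ^ p = 1 :=
  rTensor_pow_eq_one (letter_pow_eq_one hη l)

/-- The U-factor of X sends one even (odd) basis vector to a combination of odd (even) ones, so it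
squares to zero. -/
theorem twistX_mul_self (l : Label g) : twistX (p := p) η l * twistX η l = 0 := by
  rcases l with k | k
  · exact map_mul_self_of_sq_eq_zero (sendTo_mul_self (du_inl_inr k k))
  · exact map_mul_self_of_sq_eq_zero (sendTo_mul_self (du_inr_inl k k))

theorem twistX_mul_twistY (hη : η ^ p = 1) (l : Label g) :
    twistX (p := p) η l * twistY η l = η • (twistY η l * twistX η l) := by
  rcases l with k | k
  · refine map_mul_rTensor_of_twist ?_
    refine LinearMap.ext fun v => ?_
    have h := LinearMap.congr_fun (oddWord_twist hη k) v
    simp only [LinearMap.smul_apply, Module.End.mul_apply] at h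
    simp only [LinearMap.smul_apply, Module.End.mul_apply, LinearMap.neg_apply, map_neg, h,
      smul_neg]
  · exact map_mul_rTensor_of_twist (evenWord_twist hη k)

theorem specHom_twistY_tmul (hη : IsPrimitiveRoot η p) (l : Label g) (f : ZMod p → ℂ) (v : V p g)
    (x : U g) : specHom hη (twistY_pow hη.pow_eq_one l) f (v ⊗ₜ[ℂ] x) =
      specHom hη (letter_pow_eq_one hη.pow_eq_one l) f v ⊗ₜ[ℂ] x := by
  have h : specHom hη (twistY_pow hη.pow_eq_one l) f =
      (specHom hη (letter_pow_eq_one hη.pow_eq_one l) f).rTensor (U g) :=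
    specHom_rTensor hη (letter_pow_eq_one hη.pow_eq_one l) _ f
  rw [h, LinearMap.rTensor_tmul]

theorem psi_eq_specHom (hp : p ≠ 2) (hη : IsPrimitiveRoot η p) (l : Label g) :
    psi η l = specHom hη (letter_pow_eq_one hη.pow_eq_one l) fun i => pw η (tau i) := by
  rcases l with k | k
  · exact psi_inl hη k
  · exact psi_inr hp hη k

theorem psiHat_eq (hp : p ≠ 2) (hη : IsPrimitiveRoot η p) (l : Label g) :
    psiHat η l = (1 + twistX η l) *
      specHom hη (twistY_pow hη.pow_eq_one l) fun i => pw η (tau i) := by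
  refine TensorProduct.ext' fun v x => ?_
  rw [Module.End.mul_apply, specHom_twistY_tmul, ← psi_eq_specHom hp hη]
  rcases l with k | k
  · simp [psiHat, twistX, sub_eq_add_neg, TensorProduct.neg_tmul]
  · simp [psiHat, twistX]

theorem tmul_u_ne_zero {n : ℕ} {v : V n g} (hv : v ≠ 0) (l : Label g) : v ⊗ₜ[ℂ] u l ≠ 0 := by
  intro h
  -- Contracting the second factor with the l-th coordinate functional returns v.
  have := congrArg (fun z => TensorProduct.rid ℂ (V n g)
    ((LinearMap.proj l : U g →ₗ[ℂ] ℂ).lTensor (V n g) z)) h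
  simp [u, hv] at this

theorem specProj_letter_ne_zero (hη : IsPrimitiveRoot η p) (l : Label g) (i : ZMod p) :
    specProj η (letter (p := p) η (l, 1)) i ≠ 0 := by
  rcases l with k | k
  · exact specProj_ne_zero_of_twist hη (isUnit_rightAct hη.pow_eq_one _)
      (oddWord_twist hη.pow_eq_one k) i
  · exact specProj_ne_zero_of_twist hη (isUnit_rightAct_wordInv hη.pow_eq_one _)
      (evenWord_twist hη.pow_eq_one k) i

theorem twistX_tmul_u_self (l : Label g) (v : V p g) : twistX η l (v ⊗ₜ[ℂ] u l) = 0 := by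
  rcases l with k | k <;> simp [twistX, sendTo_u]

theorem exists_eigenvector (hη : IsPrimitiveRoot η p) (l : Label g) (i : ZMod p) :
    ∃ v : L p g, v ≠ 0 ∧ specProj η (twistY η l) i v = v ∧ twistX η l v = 0 := by
  obtain ⟨v, hv⟩ : ∃ v, specProj η (letter (p := p) η (l, 1)) i v ≠ 0 := by
    by_contra! h
    exact specProj_letter_ne_zero hη l i (LinearMap.ext h)
  -- X reads only the u-component of the parity opposite to l, so tensoring with `u l` guarantees
  -- that X annihilates the vector.
  refine ⟨specProj η (letter η (l, 1)) i v ⊗ₜ[ℂ] u l, tmul_u_ne_zero hv l, ?_,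
    twistX_tmul_u_self l _⟩
  rw [twistY, specProj_rTensor, LinearMap.rTensor_tmul, ← Module.End.mul_apply,
    specProj_mul_specProj hη (letter_pow_eq_one hη.pow_eq_one l), if_pos rfl]

/-- The semisimple part of `Ψ̂_l`. -/
def semisimplePart (hη : IsPrimitiveRoot η p) (l : Label g) : Module.End ℂ (L p g) :=
  twistHom hη (twistY_pow hη.pow_eq_one l) (twistX_mul_self l)
    (twistX_mul_twistY hη.pow_eq_one l) fun i => pw η (tau i)

/-- The unipotent part of `Ψ̂_l`. -/
def unipotentPart (p : ℕ) {g : ℕ} [Fact p.Prime] (η : ℂ) (l : Label g) : Module.End ℂ (L p g) :=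
  1 + twistX η l * specProj η (twistY η l) (0 : ZMod p)

theorem isMulJordan_psiHat (hp : p ≠ 2) (hη : IsPrimitiveRoot η p) (l : Label g) :
    IsMulJordan (psiHat η l) (semisimplePart hη l) (unipotentPart p η l) :=
  psiHat_eq hp hη l ▸ isMulJordan_twist hp hη _ _ _

theorem semisimplePart_pow (hη : IsPrimitiveRoot η p) (l : Label g) :
    semisimplePart hη l ^ p = 1 :=
  twistHom_tau_pow hη _ _ _

theorem eq_of_isMulJordan_psiHat (hp : p ≠ 2) (hη : IsPrimitiveRoot η p) (l : Label g)
    {S T : Module.End ℂ (L p g)} (h : IsMulJordan (psiHat η l) S T) :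
    S = semisimplePart hη l ∧ T = unipotentPart p η l :=
  (isMulJordan_psiHat hp hη l).unique h
    (IsUnit.of_pow_eq_one (semisimplePart_pow hη l) (Fact.out : p.Prime).ne_zero)

theorem unipotentPart_apply (hη : IsPrimitiveRoot η p) (l : Label g) (v : V p g) (x : U g) :
    (unipotentPart p η l - 1) (v ⊗ₜ[ℂ] x) =
      twistX η l (specHom hη (letter_pow_eq_one hη.pow_eq_one l)
        (fun i => if i = 0 then 1 else 0) v ⊗ₜ[ℂ] x) := by
  rw [unipotentPart, LinearMap.sub_apply, LinearMap.add_apply, Module.End.one_apply,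
    add_sub_cancel_left, Module.End.mul_apply,
    ← specHom_single hη (twistY_pow hη.pow_eq_one l), specHom_twistY_tmul]

theorem specProj_semisimplePart_apply (hη : IsPrimitiveRoot η p) (l : Label g) (a : ZMod p)
    (v : V p g) (x : U g) :
    specProj η (semisimplePart hη l) a (v ⊗ₜ[ℂ] x) =
      specHom hη (letter_pow_eq_one hη.pow_eq_one l) (fun i => if a = tau i then 1 else 0) v
        ⊗ₜ[ℂ] x +
      twistX η l (specHom hη (letter_pow_eq_one hη.pow_eq_one l)
        (fun i => kappa η i *
          ((if a = tau i then 1 else 0) - (if a = tau (i - 1) then 1 else 0))) v ⊗ₜ[ℂ] x) := by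
  rw [semisimplePart, specProj_algHom hη, twistHom_apply, LinearMap.add_apply,
    Module.End.mul_apply, specHom_twistY_tmul, specHom_twistY_tmul]

/-! ### Explicit formulas -/

theorem twistX_inl (hη : η ^ p = 1) (k : Fin g) (j : MultiIndex p g) (m : Label g) (c : ℂ) :
    twistX η (Sum.inl k) ((c • e j) ⊗ₜ[ℂ] u m) = if m = Sum.inr k then
      -((c * pw η (∑ r ∈ Finset.Iio k, j r)) • (e (j - re p g k) ⊗ₜ[ℂ] du (Sum.inl k)))
      else 0 := by
  simp only [twistX, TensorProduct.map_tmul, sendTo_u, LinearMap.neg_apply, map_smul,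
    rightAct_oddWord hη]
  split_ifs
  · rw [smul_neg, smul_smul, TensorProduct.neg_tmul, ← TensorProduct.smul_tmul']
  · rw [TensorProduct.tmul_zero]

theorem twistX_inr_specHom (hη : IsPrimitiveRoot η p) (k : Fin g) (j : MultiIndex p g)
    (m : Label g) (f : ZMod p → ℂ) :
    twistX η (Sum.inr k) (specHom hη (letter_pow_eq_one hη.pow_eq_one (Sum.inr k)) f (e j)
      ⊗ₜ[ℂ] u m) = if m = Sum.inl k then
      (p : ℂ)⁻¹ • ∑ s : ZMod p, (pw η (-∑ r ∈ Finset.Iic k, j r) * pw η (-s) *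
        ∑ i, f i * pw η (i * (s - 1))) •
        (e (j + s • re p g k + (1 - s) • re p g (k + 1)) ⊗ₜ[ℂ] du (Sum.inr k)) else 0 := by
  have h : rightAct η (wordInv (evenWord k))
      (specHom hη (letter_pow_eq_one hη.pow_eq_one (Sum.inr k)) f (e j)) =
      (p : ℂ)⁻¹ • ∑ s : ZMod p, (pw η (-∑ r ∈ Finset.Iic k, j r) * pw η (-s) *
        ∑ i, f i * pw η (i * (s - 1))) • e (j + s • re p g k + (1 - s) • re p g (k + 1)) := by
    -- The inverse word adds re k; replacing s by s - 1 absorbs it and leaves the phase -s and the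
    -- characters η^(i(s-1)).
    rw [specHom_inr, map_smul, map_sum, ← Equiv.sum_comp (Equiv.subRight (1 : ZMod p))]
    congr 1
    refine Finset.sum_congr rfl fun s _ => ?_
    have h1 : -(∑ r ∈ Finset.Iic k, (j + (s - 1) • (re p g k - re p g (k + 1))) r) - 1 =
        -∑ r ∈ Finset.Iic k, j r + -s := by
      simp only [Pi.add_apply, Pi.smul_apply, Pi.sub_apply, smul_eq_mul, Finset.sum_add_distrib,
        ← Finset.mul_sum, Finset.sum_sub_distrib, sum_Iic_re, sum_Iic_re_succ]
      ring
    have h2 : j + (s - 1) • (re p g k - re p g (k + 1)) + re p g k =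
        j + s • re p g k + (1 - s) • re p g (k + 1) := by
      module
    rw [Equiv.subRight_apply, map_smul, rightAct_evenWord_inv hη.pow_eq_one, smul_smul, h1, h2,
      pw_add hη.pow_eq_one, mul_comm]
  simp only [twistX, TensorProduct.map_tmul, sendTo_u, h]
  split_ifs
  · simp only [← TensorProduct.smul_tmul', TensorProduct.sum_tmul]
  · rw [TensorProduct.tmul_zero]

end Twisted

/-! ### The constants -/

section Constants

variable {p : ℕ} [Fact p.Prime] {η : ℂ}

theorem rootM_sq (hp : p ≠ 2) {a : ZMod p} (ha : a ∈ Ip p) : rootM a ^ 2 = 2 * a + 4⁻¹ := by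
  have h2 := two_ne_zero_zmod hp
  have h4 : (4 : ZMod p) ≠ 0 := by
    rw [show (4 : ZMod p) = 2 * 2 by norm_num]
    exact mul_ne_zero h2 h2
  have hex : ∃ m : ℕ, m ≤ (p - 1) / 2 ∧ (m : ZMod p) ^ 2 = 2 * a + 4⁻¹ := by
    obtain ⟨i, rfl⟩ := ha
    have key : (i + 2⁻¹) ^ 2 = 2 * tau i + 4⁻¹ := by
      rw [tau, show (4 : ZMod p) = 2 * 2 by norm_num]
      field_simp
      ring
    have hodd := (Fact.out : p.Prime).eq_two_or_odd.resolve_left hp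
    -- Since 2τ(i) + 1/4 = (i + 1/2)^2, the least absolute residue of i + 1/2 is a root up to sign,
    -- and p odd bounds it by (p - 1)/2.
    refine ⟨(i + 2⁻¹).valMinAbs.natAbs, ?_, ?_⟩
    · have := ZMod.natAbs_valMinAbs_le (i + 2⁻¹)
      omega
    · rw [← key, ← Int.cast_natCast, Int.natCast_natAbs, ← Int.cast_pow, sq_abs, Int.cast_pow,
        ZMod.coe_valMinAbs]
  rw [rootM, dif_pos hex]
  exact (Nat.find_spec hex).2

theorem eq_tau_iff (hp : p ≠ 2) {a : ZMod p} (ha : a ∈ Ip p) (i : ZMod p) :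
    a = tau i ↔ i = rootM a - 2⁻¹ ∨ i = -rootM a - 2⁻¹ := by
  have h2 := two_ne_zero_zmod hp
  have h := rootM_sq hp ha
  have h4 : (4 : ZMod p)⁻¹ = 2⁻¹ * 2⁻¹ := by
    rw [show (4 : ZMod p) = 2 * 2 by norm_num, mul_inv]
  have h22 : (2 : ZMod p) * 2⁻¹ = 1 := mul_inv_cancel₀ h2
  have e1 : (i + 2⁻¹ - rootM a) * (i + 2⁻¹ + rootM a) = 2 * (tau i - a) := by
    rw [tau]
    linear_combination (-1 : ZMod p) * h - h4 - i ^ 2 * h22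
  constructor
  · intro ha
    rw [← ha, sub_self, mul_zero] at e1
    rcases mul_eq_zero.1 e1 with h | h
    · left
      linear_combination h
    · right
      linear_combination h
  · intro hi
    have : 2 * (tau i - a) = 0 := by
      rw [← e1]
      rcases hi with h | h <;> rw [h] <;> ring
    exact (sub_eq_zero.1 ((mul_eq_zero.1 this).resolve_left h2)).symm

theorem rootM_eq_zero_iff (hp : p ≠ 2) {a : ZMod p} (ha : a ∈ Ip p) :
    rootM a = 0 ↔ a = -8⁻¹ := by
  have h2 := two_ne_zero_zmod hp
  have h := rootM_sq hp ha
  have h8 : (8 : ZMod p)⁻¹ = 2⁻¹ * 4⁻¹ := by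
    rw [show (8 : ZMod p) = 2 * 4 by norm_num, mul_inv]
  rw [← sq_eq_zero_iff, h, h8, ← mul_right_inj' h2 (b := a)]
  have h22 : (2 : ZMod p) * 2⁻¹ = 1 := mul_inv_cancel₀ h2
  constructor
  · intro h
    linear_combination h + 4⁻¹ * h22
  · intro h
    linear_combination h - 4⁻¹ * h22

/-- A sum over `τ i = a` is a sum over the square roots of `2 a + 1/4`. -/
theorem sum_tau_eq (hp : p ≠ 2) (a : ZMod p) (f : ZMod p → ℂ) :
    open scoped Classical in
    ∑ i, (if a = tau i then f i else 0) =
      if a ∉ Ip p then 0 else if a = -8⁻¹ then f (-2⁻¹)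
      else f (rootM a - 2⁻¹) + f (-rootM a - 2⁻¹) := by
  classical
  by_cases ha : a ∈ Ip p
  · rw [if_neg (not_not.2 ha)]
    simp only [eq_tau_iff hp ha]
    split_ifs with h
    · simp [(rootM_eq_zero_iff hp ha).2 h]
    · have hm : rootM a - 2⁻¹ ≠ -rootM a - 2⁻¹ := by
        intro h'
        have h3 : 2 * rootM a = 0 := by linear_combination h'
        exact h ((rootM_eq_zero_iff hp ha).1 ((mul_eq_zero.1 h3).resolve_left
          (two_ne_zero_zmod hp)))
      rw [← Finset.sum_filter, ← Finset.sum_pair hm]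
      congr 1
      ext i
      simp
  · rw [if_pos ha]
    exact Finset.sum_eq_zero fun i _ => if_neg fun h => ha ⟨i, h.symm⟩

/-- The solutions i = ±m - 1/2 share the factor η^(-s/2), and the remaining characters add up to B.
-/
theorem constB_eq (hp : p ≠ 2) (hη : IsPrimitiveRoot η p) (a s : ZMod p) :
    ∑ i, (if a = tau i then 1 else 0) * pw η (i * s) =
      pw η (-(s * 2⁻¹)) * constB η a s := by
  classical
  simp only [ite_mul, one_mul, zero_mul]
  rw [sum_tau_eq hp a fun i => pw η (i * s), constB]
  split_ifs
  · rw [mul_one]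
    congr 1
    ring
  · rw [mul_add, ← pw_add hη.pow_eq_one, ← pw_add hη.pow_eq_one]
    congr 2 <;> ring
  · rw [mul_zero]

/-- The term of `C^a_s` that belongs to `c`. -/
def termF (η : ℂ) (s c : ZMod p) : ℂ :=
  (pw η (c * (s - 2⁻¹)) + pw η (-(c * (s - 2⁻¹)))) * (pw η (2⁻¹ * c) - pw η (-(2⁻¹ * c)))⁻¹

/-- The denominator vanishes here, and 0⁻¹ = 0 matches κ(0) = 0: the index i = 0 contributes
nothing. -/
theorem termF_zero (s : ZMod p) : termF η s 0 = 0 := by simp [termF]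

theorem termF_neg (s c : ZMod p) : termF η s (-c) = -termF η s c := by
  rw [termF, termF, neg_mul c, mul_neg 2⁻¹, neg_neg, neg_neg,
    ← neg_sub (pw η (2⁻¹ * c)), inv_neg, mul_neg, add_comm]

/-- Multiplying numerator and denominator by η^(i/2) makes the denominator odd in i, which prepares
the pairing of i with -i. -/
theorem kappa_mul_pw (hp : p ≠ 2) (hη : IsPrimitiveRoot η p) (s i : ZMod p) :
    kappa η i * pw η (i * (s - 1)) =
      pw η (i * (s - 2⁻¹)) * (pw η (2⁻¹ * i) - pw η (-(2⁻¹ * i)))⁻¹ := by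
  have h22 : (2 : ZMod p) * 2⁻¹ = 1 := mul_inv_cancel₀ (two_ne_zero_zmod hp)
  have h1 : pw η (2⁻¹ * i) - pw η (-(2⁻¹ * i)) = pw η (2⁻¹ * i) * (1 - pw η (-i)) := by
    rw [mul_sub, mul_one, ← pw_add hη.pow_eq_one]
    congr 2
    linear_combination -i * h22
  have h3 : i * (s - 2⁻¹) = 2⁻¹ * i + i * (s - 1) := by
    linear_combination -i * h22
  rw [h1, h3, pw_add hη.pow_eq_one, kappa]
  have h4 := pw_ne_zero hη.pow_eq_one (2⁻¹ * i)
  generalize pw η (2⁻¹ * i) = z at h4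
  generalize 1 - pw η (-i) = w
  rw [mul_inv]
  field_simp

theorem constC_eq (hp : p ≠ 2) (hη : IsPrimitiveRoot η p) (a s : ZMod p) :
    ∑ i, kappa η i * ((if a = tau i then 1 else 0) - (if a = tau (i - 1) then 1 else 0)) *
      pw η (i * (s - 1)) = constC η a s := by
  classical
  have h2 := two_ne_zero_zmod hp
  have h22 : (2 : ZMod p) * 2⁻¹ = 1 := mul_inv_cancel₀ h2
  have h1 : ∑ i, kappa η i * ((if a = tau i then 1 else 0) - (if a = tau (i - 1) then 1 else 0)) *
      pw η (i * (s - 1)) = ∑ i, if a = tau i then termF η s i else 0 := by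
    -- Reflection i ↦ -i with τ(-i - 1) = τ(i) moves both indicators to the same condition τ(i) = a;
    -- the two summands then combine into `termF`.
    have e1 : ∑ i, kappa η i * (if a = tau (i - 1) then 1 else 0) * pw η (i * (s - 1)) =
        ∑ i, kappa η (-i) * (if a = tau i then 1 else 0) * pw η (-i * (s - 1)) := by
      rw [← Equiv.sum_comp (Equiv.neg (ZMod p))]
      refine Finset.sum_congr rfl fun i _ => ?_
      have : tau (-i - 1) = tau i := by
        simp only [tau]
        ring
      rw [Equiv.neg_apply, this]
    simp only [mul_sub (kappa η _), sub_mul (kappa η _ * _) (kappa η _ * _),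
      Finset.sum_sub_distrib]
    rw [e1, ← Finset.sum_sub_distrib]
    refine Finset.sum_congr rfl fun i _ => ?_
    split_ifs
    · have a1 := kappa_mul_pw hp hη s i
      have a2 := kappa_mul_pw hp hη s (-i)
      rw [mul_one, mul_one, a1, a2, termF, mul_neg 2⁻¹, neg_mul i, neg_neg,
        ← neg_sub (pw η (2⁻¹ * i)), inv_neg]
      ring
    · simp
  rw [h1, sum_tau_eq hp a, constC]
  have h4 : (4 : ZMod p)⁻¹ = 2⁻¹ * 2⁻¹ := by
    rw [show (4 : ZMod p) = 2 * 2 by norm_num, mul_inv]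
  by_cases ha : a ∈ Ip p
  swap
  · rw [if_pos ha, if_pos ha]
  rw [if_neg (not_not.2 ha), if_neg (not_not.2 ha)]
  by_cases h0 : a = 0
  · have h8 : a ≠ -8⁻¹ := by
      rw [h0, show (8 : ZMod p) = 2 * (2 * 2) by norm_num]
      exact (neg_ne_zero.2 (inv_ne_zero (mul_ne_zero h2 (mul_ne_zero h2 h2)))).symm
    have hr := rootM_sq hp ha
    rw [if_neg h8, if_pos h0]
    have hF : termF η s (-1) = (pw η (s - 2⁻¹) + pw η (-(s - 2⁻¹))) *
        (pw η (-2⁻¹ : ZMod p) - pw η (2⁻¹ : ZMod p))⁻¹ := by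
      rw [termF, add_comm]
      simp
    have : (rootM a - 2⁻¹) * (rootM a + 2⁻¹) = 0 := by
      linear_combination hr + 2 * h0 + h4
    -- For a = 0 the roots of τ are 0 and -1. Only the square of `rootM` is known, so both signs of
    -- m = ±1/2 are treated; each leaves the term at -1.
    rcases mul_eq_zero.1 this with h | h
    · have e2 : -rootM a - 2⁻¹ = -1 := by linear_combination -h - h22
      rw [h, e2, termF_zero, zero_add, hF]
    · have e2 : -rootM a - 2⁻¹ = 0 := by linear_combination -h
      have e3 : rootM a - 2⁻¹ = -1 := by linear_combination h - h22
      rw [e2, e3, termF_zero, add_zero, hF]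
  · rw [if_neg h0]
    split_ifs with h8
    · rw [termF, h4, add_comm]
      simp
    · rw [show -rootM a - 2⁻¹ = -(rootM a + 2⁻¹) by ring, termF_neg, ← sub_eq_add_neg, termF,
        termF]

end Constants

end Braid

end

open Braid in
theorem mainTheorem9 (p g : ℕ) [Fact p.Prime] (hp : p ≠ 2) (η : ℂ) (hη : IsPrimitiveRoot η p) :
    -- every operator has exactly one multiplicative Jordan decomposition
    (∀ l : Label g, ∃! ST : Module.End ℂ (L p g) × Module.End ℂ (L p g),
      IsMulJordan (psiHat η l) ST.1 ST.2) ∧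
    -- the operators `specProj η S a` are the spectral projections of the semisimple part
    (∀ (l : Label g) (S T : Module.End ℂ (L p g)), IsMulJordan (psiHat η l) S T →
      S ^ p = 1 ∧
      ∀ a : ZMod p,
        LinearMap.IsProj (Module.End.eigenspace S (pw η a)) (specProj η S a) ∧
        LinearMap.ker (specProj η S a) =
          ⨆ b : ZMod p, ⨆ _ : b ≠ a, Module.End.eigenspace S (pw η b)) ∧
    -- odd labels `2k - 1`: unipotent part and spectral projections
    (∀ (k : Fin g) (S T : Module.End ℂ (L p g)), IsMulJordan (psiHat η (Sum.inl k)) S T →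
      ∀ (m : Label g) (j : MultiIndex p g),
        (T - 1) (e j ⊗ₜ[ℂ] u m) =
          (if m = Sum.inr k ∧ j k = 0 then
            -(pw η (∑ r ∈ Finset.Iio k, j r) •
              (e (j - re p g k) ⊗ₜ[ℂ] du (Sum.inl k))) else 0) ∧
        ∀ a : ZMod p,
          specProj η S a (e j ⊗ₜ[ℂ] u m) =
            (if a = tau (j k) then (1 : ℂ) else 0) • (e j ⊗ₜ[ℂ] u m) -
            (if m = Sum.inr k ∧ j k ≠ 0 then
              (((if a = tau (j k) then (1 : ℂ) else 0) - (if a = tau (j k - 1) then 1 else 0)) *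
                (1 - pw η (-(j k)))⁻¹ * pw η (∑ r ∈ Finset.Iio k, j r)) •
                (e (j - re p g k) ⊗ₜ[ℂ] du (Sum.inl k)) else 0)) ∧
    -- even labels `2k`: unipotent part and spectral projections
    (∀ (k : Fin g) (S T : Module.End ℂ (L p g)), IsMulJordan (psiHat η (Sum.inr k)) S T →
      ∀ (m : Label g) (i : MultiIndex p g),
        (T - 1) (e i ⊗ₜ[ℂ] u m) =
          (if m = Sum.inl k then
            ((p : ℂ)⁻¹ * pw η (-∑ r ∈ Finset.Iic k, i r)) •
              ∑ s : ZMod p, pw η (-s) •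
                (e (i + s • re p g k + (1 - s) • re p g (k + 1)) ⊗ₜ[ℂ] du (Sum.inr k))
            else 0) ∧
        ∀ a : ZMod p,
          specProj η S a (e i ⊗ₜ[ℂ] u m) =
            (p : ℂ)⁻¹ • ∑ s : ZMod p, (pw η (-(s * 2⁻¹)) * constB η a s) •
              (e (i + s • (re p g k - re p g (k + 1))) ⊗ₜ[ℂ] u m) +
            (if m = Sum.inl k then
              (p : ℂ)⁻¹ • ∑ s : ZMod p,
                (pw η (-∑ r ∈ Finset.Iic k, i r) * pw η (-s) * constC η a s) •
                  (e (i + s • re p g k + (1 - s) • re p g (k + 1)) ⊗ₜ[ℂ] du (Sum.inr k))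
              else 0)) ∧
    -- the spectrum
    (∀ l : Label g, spectrum ℂ (psiHat (p := p) η l) = {z : ℂ | ∃ a ∈ Ip p, z = pw η a}) := by
  refine ⟨fun l => ?_, fun l S T h => ?_, fun k S T h m j => ?_, fun k S T h m i => ?_,
    fun l => ?_⟩
  · refine ⟨(semisimplePart hη l, unipotentPart p η l), isMulJordan_psiHat hp hη l,
      fun ST h => ?_⟩
    obtain ⟨h1, h2⟩ := eq_of_isMulJordan_psiHat hp hη l h
    exact Prod.ext h1 h2
  · obtain ⟨rfl, -⟩ := eq_of_isMulJordan_psiHat hp hη l h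
    exact ⟨semisimplePart_pow hη l, fun a => ⟨isProj_specProj hη (semisimplePart_pow hη l) a,
      ker_specProj hη (semisimplePart_pow hη l) a⟩⟩
  · obtain ⟨rfl, rfl⟩ := eq_of_isMulJordan_psiHat hp hη _ h
    refine ⟨?_, fun a => ?_⟩
    · rw [unipotentPart_apply hη, specHom_inl, twistX_inl hη.pow_eq_one]
      by_cases hm : m = Sum.inr k <;> by_cases hj : j k = 0 <;> simp [hm, hj]
    · rw [specProj_semisimplePart_apply, specHom_inl, specHom_inl, twistX_inl hη.pow_eq_one,
        ← TensorProduct.smul_tmul']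
      refine (congrArg₂ (· + ·) rfl ?_).trans (sub_eq_add_neg _ _).symm
      by_cases hm : m = Sum.inr k
      · by_cases hj : j k = 0
        -- For j_k = 0 the correction disappears because κ(0) = 0⁻¹ = 0, in agreement with the
        -- condition j_k ≠ 0.
        · simp [hj, kappa, pw_zero]
        · rw [if_pos hm, if_pos (And.intro hm hj), kappa, mul_comm (1 - _)⁻¹]
      · simp [hm]
  · obtain ⟨rfl, rfl⟩ := eq_of_isMulJordan_psiHat hp hη _ h
    refine ⟨?_, fun a => ?_⟩
    · rw [unipotentPart_apply hη, twistX_inr_specHom]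
      simp [pw_zero, Finset.smul_sum, smul_smul, mul_assoc]
    · rw [specProj_semisimplePart_apply, twistX_inr_specHom, specHom_inr]
      simp only [constB_eq hp hη, constC_eq hp hη, ← TensorProduct.smul_tmul',
        TensorProduct.sum_tmul]
  · rw [psiHat_eq hp hη l]
    exact spectrum_twist hp hη _ (twistX_mul_self l) (twistX_mul_twistY hη.pow_eq_one l)
      (exists_eigenvector hη l)
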